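/- **Setting.** Let $\mathbf A$ be a set of actions and $\mathbf F$ a set of fluents. An action description $D$ is a set of propositions "$a$ causes $l$ if $p_1,\dots,p_m$", "$l$ if $p_1,\dots,p_m$" (static causal laws), "$a$ executable\_if $p_1,\dots,p_m$" with $a\in\mathbf A$ and fluent literals $l,p_i$; $I$ is a set of fluent literals (the initial ones). A state is a complete and consistent set of fluent literals satisfying the static laws. An action $a$ is executable in $s$ if the body of one of its executability conditions holds in $s$; $\Phi(a,s)$ is the set of states $s'$ with $s'=\mathrm{Cl}_D(E(a,s)\cup(s\cap s'))$ if $a$ is executable in $s$, and is empty otherwise, where $E(a,s)$ is the set of direct effects and $\mathrm{Cl}_D$ is closure under the static laws. $(D,I)$ is consistent if $I$ is a state and $\Phi(a,s)\neq\emptyset$ whenever $a$ is executable in the state $s$. A trajectory is a sequence $s_0a_1s_1\dots a_ks_k$ of states and actions with $s_{i+1}\in\Phi(a_{i+1},s_i)$; it achieves a fluent formula $G$ if $s_0\models I$ and $s_k\models G$; $\alpha[i]=s_ia_{i+1}\dots a_ks_k$ for $0\le i\le k$. Basic desires are built from fluent literals, $occ(a)$ and $\mathbf{goal}(\psi)$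 ($\psi$ a fluent formula) by $\wedge,\vee,\neg,\mathbf{next},\mathbf{until},\mathbf{always},\mathbf{eventually}$. For $\alpha=s_0a_1\dots a_ks_k$: $\alpha\models l$ iff $l\in s_0$; $\alpha\models occ(a)$ iff $k\ge1$ and $a_1=a$; $\alpha\models\mathbf{goal}(\psi)$ iff $s_k\models\psi$; the connectives $\wedge,\vee,\neg$ are classical; $\alpha\models\mathbf{next}(\varphi)$ iff $k\ge 1$ and $\alpha[1]\models\varphi$; $\alpha\models\mathbf{always}(\varphi)$ (resp. $\mathbf{eventually}(\varphi)$) iff $\alpha[i]\models\varphi$ for all (resp. some) $0\le i\le k$; $\alpha\models\mathbf{until}(\varphi_1,\varphi_2)$ iff for some $0\le i\le k$, $\alpha[i]\models\varphi_2$ and $\alpha[j]\models\varphi_1$ for all $j<i$. A trajectory $\alpha$ is most preferred w.r.t. $\varphi$ if there is no trajectory $\beta$ with $\beta\models\varphi$ and $\alpha\not\models\varphi$. **Programs.** Let $n$ be the maximal plan length; all times range over $0,\dots,n$. $\Pi(D,I,G)$ consists of the facts $literal(l)$ for fluent literals $l$ and the ground rules * $holds(l,0)$ for $l\in I$; * $possible(a,t)\leftarrow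 holds(p_1,t),\dots,holds(p_m,t)$ for each executability condition; * $holds(l,t+1)\leftarrow occ(a,t),holds(p_1,t),\dots,holds(p_m,t)$ for each causal law, and $holds(l,t)\leftarrow holds(p_1,t),\dots,holds(p_m,t)$ for each static law; * $holds(l,t+1)\leftarrow holds(l,t),\textit{not }holds(\bar l,t+1)$, where $\bar l$ is the complement of $l$, and $\leftarrow holds(f,t),holds(\neg f,t)$ for each fluent $f$; * $occ(a,t)\leftarrow possible(a,t),\textit{not }nocc(a,t)$ for $t<n$, and $nocc(a,t)\leftarrow occ(b,t)$ for $a\ne b$, $t<n$; * the rules defining $h(\psi,t)$ (truth at time $t$) for the subformulae $\psi$ of $G$ from $holds$ by recursion on $\psi$, and the constraint $\leftarrow\textit{not }h(G,n)$. Each basic desire $\eta$ has a unique name $n_\eta$ ($n_l=l$ for a literal $l$). $\Pi_\varphi$ consists of the facts $desire(l)$ for all fluent literals $l$ and, for each subformula $\eta$ of $\varphi$, the fact $desire(n_\eta)$ and the fact describing its outermost operator: $goal(n_\eta,n_\psi)$ for $\eta=\mathbf{goal}(\psi)$, $happen(n_\eta,a)$ for $\eta=occ(a)$, $and(n_\eta,n_{\eta_1},n_{\eta_2})$,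 $or(n_\eta,n_{\eta_1},n_{\eta_2})$, $negation(n_\eta,n_{\eta_1})$, $next(n_\eta,n_{\eta_1})$, $until(n_\eta,n_{\eta_1},n_{\eta_2})$, $always(n_\eta,n_{\eta_1})$, $eventually(n_\eta,n_{\eta_1})$. $\Pi_{sat}$ consists of the ground instances ($T,T_1\in\{0,\dots,n\}$) of the following rules, where each body also contains $desire(F)$: * $satisfy(F,T)\leftarrow goal(F,F_1),satisfy(F_1,n)$; * $satisfy(F,T)\leftarrow happen(F,A),occ(A,T)$; * $satisfy(F,T)\leftarrow literal(F),holds(F,T)$; * $satisfy(F,T)\leftarrow and(F,F_1,F_2),satisfy(F_1,T),satisfy(F_2,T)$; * $satisfy(F,T)\leftarrow or(F,F_1,F_2),satisfy(F_i,T)$ for $i=1,2$; * $satisfy(F,T)\leftarrow negation(F,F_1),\textit{not }satisfy(F_1,T)$; * $satisfy(F,T)\leftarrow until(F,F_1,F_2),T<T_1,during(F_1,T,T_1-1),satisfy(F_2,T_1)$; * $satisfy(F,T)\leftarrow until(F,F_1,F_2),satisfy(F_2,T)$; * $satisfy(F,T)\leftarrow always(F,F_1),during(F_1,T,n)$; *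 $satisfy(F,T)\leftarrow next(F,F_1),satisfy(F_1,T+1)$; * $satisfy(F,T)\leftarrow eventually(F,F_1),T\le T_1,satisfy(F_1,T_1)$; * $during(F,T,T_1)\leftarrow T<T_1,satisfy(F,T),during(F,T+1,T_1)$; * $during(F,T,T)\leftarrow satisfy(F,T)$. **Theorem.** Let $\langle D,I,G\rangle$ be a planning problem with $(D,I)$ consistent, $n\ge0$, $\varphi$ a basic desire, and let $M$ be an answer set of $\Pi(D,I,G,\varphi)=\Pi(D,I,G)\cup\Pi_\varphi\cup\Pi_{sat}$. Then there is exactly one sequence $\alpha_M=s_0a_1\dots a_ks_k$ with $k\le n$ represented by $M$, i.e. with $s_i=\{l\mid holds(l,i)\in M\}$ for $0\le i\le k$ and $\{occ(a_i,i-1)\mid 1\le i\le k\}$ the set of all atoms $occ(a,t)$ in $M$, and $\alpha_M$ is a trajectory achieving $G$. If $\alpha_M$ has length $k=n$, or if $\mathbf{next}$ does not occur in $\varphi$, then $$\alpha_M\models\varphi\iff satisfy(n_\varphi,0)\in M,$$ and if $satisfy(n_\varphi,0)\in M$, then $\alpha_M$ is a most preferred trajectory w.r.t. $\varphi$. -/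

import Mathlib

namespace PlanPref

/-! ### Logic programs and answer sets -/

/-- A ground rule `head ← pos₁, …, posₘ, not neg₁, …, not negₖ`; the head `none` makes it a
constraint. -/
structure Rule (At : Type*) where
  head : Option At
  pos : List At
  neg : List At

/-- A rule without body. -/
def Rule.fact {At : Type*} (a : At) : Rule At := ⟨some a, [], []⟩

/-- The Gelfond-Lifschitz reduct of `P` with respect to `M`. -/
def reduct {At : Type*} (P : Set (Rule At)) (M : Set At) : Set (Rule At) :=
  {r | ∃ r₀ ∈ P, (∀ b ∈ r₀.neg, b ∉ M) ∧ r = ⟨r₀.head, r₀.pos, []⟩}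

/-- `X` is a model of the program `P`. -/
def IsModel {At : Type*} (P : Set (Rule At)) (X : Set At) : Prop :=
  ∀ r ∈ P, (∀ b ∈ r.pos, b ∈ X) → (∀ b ∈ r.neg, b ∉ X) → ∃ a, r.head = some a ∧ a ∈ X

/-- `M` is an answer set of `P`: it is the least model of the reduct of `P` with respect to `M`. -/
def IsAnswerSet {At : Type*} (P : Set (Rule At)) (M : Set At) : Prop :=
  IsLeast {X | IsModel (reduct P M) X} M

/-! ### Action theories -/

/-- Fluent literals `f` and `¬ f`. -/
inductive Literal (F : Type*) where
  | pos (f : F)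
  | neg (f : F)

/-- The complementary literal. -/
def Literal.compl {F : Type*} : Literal F → Literal F
  | .pos f => .neg f
  | .neg f => .pos f

/-- Fluent formulae: propositional formulae over fluent literals. -/
inductive FluentFormula (F : Type*) where
  | lit (l : Literal F)
  | and (ψ₁ ψ₂ : FluentFormula F)
  | or (ψ₁ ψ₂ : FluentFormula F)
  | neg (ψ : FluentFormula F)

/-- Truth of a fluent formula in a set of literals (a state). -/
def FluentFormula.Holds {F : Type*} (s : Set (Literal F)) : FluentFormula F → Prop
  | .lit l => l ∈ s
  | .and ψ₁ ψ₂ => ψ₁.Holds s ∧ ψ₂.Holds s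
  | .or ψ₁ ψ₂ => ψ₁.Holds s ∨ ψ₂.Holds s
  | .neg ψ => ¬ ψ.Holds s

/-- The propositions of an action description:
`a causes l if body`, `l if body`, and `a executable_if body`. -/
inductive Law (A F : Type*) where
  | causes (a : A) (l : Literal F) (body : List (Literal F))
  | static (l : Literal F) (body : List (Literal F))
  | executable (a : A) (body : List (Literal F))

section
variable {A F : Type*}

/-- `u` satisfies all static causal laws of `D`. -/
def StaticClosed (D : Set (Law A F)) (u : Set (Literal F)) : Prop :=
  ∀ l body, Law.static l body ∈ D → (∀ p ∈ body, p ∈ u) → l ∈ u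

/-- `Cl_D(u)`: the least superset of `u` closed under the static causal laws. -/
def staticClosure (D : Set (Law A F)) (u : Set (Literal F)) : Set (Literal F) :=
  ⋂₀ {v | u ⊆ v ∧ StaticClosed D v}

/-- States: complete and consistent sets of literals satisfying the static causal laws. -/
def IsState (D : Set (Law A F)) (s : Set (Literal F)) : Prop :=
  (∀ f : F, (Literal.pos f ∈ s ∨ Literal.neg f ∈ s) ∧ ¬ (Literal.pos f ∈ s ∧ Literal.neg f ∈ s)) ∧
    StaticClosed D s

/-- The action `a` is executable in `s`. -/
def Executable (D : Set (Law A F)) (a : A) (s : Set (Literal F)) : Prop :=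
  ∃ body, Law.executable a body ∈ D ∧ ∀ p ∈ body, p ∈ s

/-- The direct effects `E(a, s)`. -/
def directEffects (D : Set (Law A F)) (a : A) (s : Set (Literal F)) : Set (Literal F) :=
  {l | ∃ body, Law.causes a l body ∈ D ∧ ∀ p ∈ body, p ∈ s}

/-- The transition function: `Φ(a, s)` consists of the states `s'` with
`s' = Cl_D(E(a, s) ∪ (s ∩ s'))` if `a` is executable in `s`, and is empty otherwise. -/
def transition (D : Set (Law A F)) (a : A) (s : Set (Literal F)) : Set (Set (Literal F)) :=
  {s' | Executable D a s ∧ IsState D s' ∧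
    s' = staticClosure D (directEffects D a s ∪ (s ∩ s'))}

/-- Consistency of the action theory `(D, I)`; `l ∈ I` stands for `initially(l)`. -/
def Consistent (D : Set (Law A F)) (I : Set (Literal F)) : Prop :=
  IsState D I ∧
    ∀ (a : A) (s : Set (Literal F)), IsState D s → Executable D a s → (transition D a s).Nonempty

end

/-! ### Trajectories -/

/-- A sequence `s₀ a₁ s₁ … aₙ sₙ` with `n = len`, `state i = sᵢ` and `act i = aᵢ₊₁`. -/
structure Trajectory (A F : Type*) where
  len : ℕ
  state : Fin (len + 1) → Set (Literal F)
  act : Fin len → A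

/-- `α` is a trajectory of the action description `D`. -/
def Trajectory.IsTrajectory {A F : Type*} (D : Set (Law A F)) (α : Trajectory A F) : Prop :=
  (∀ i, IsState D (α.state i)) ∧
    ∀ i : Fin α.len, α.state i.succ ∈ transition D (α.act i) (α.state i.castSucc)

/-- `α` starts in a state satisfying `I` and ends in a state satisfying `G`. -/
def Trajectory.Achieves {A F : Type*} (I : Set (Literal F)) (G : FluentFormula F)
    (α : Trajectory A F) : Prop :=
  (∀ l ∈ I, l ∈ α.state 0) ∧ G.Holds (α.state (Fin.last α.len))

/-- `α[i] = sᵢ aᵢ₊₁ sᵢ₊₁ … aₙ sₙ`. -/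
def Trajectory.suffix {A F : Type*} (α : Trajectory A F) (i : ℕ) (hi : i ≤ α.len) :
    Trajectory A F where
  len := α.len - i
  state j := α.state ⟨i + j, by omega⟩
  act j := α.act ⟨i + j, by omega⟩

/-! ### Basic desires -/

/-- Basic desire formulae. The fluent formulae among them are those built from literals with the
propositional connectives, see `Desire.ofFluent`. -/
inductive Desire (A F : Type*) where
  | goal (ψ : FluentFormula F)
  | lit (l : Literal F)
  | occ (a : A)
  | and (φ₁ φ₂ : Desire A F)
  | or (φ₁ φ₂ : Desire A F)
  | neg (φ : Desire A F)
  | next (φ : Desire A F)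
  | until (φ₁ φ₂ : Desire A F)
  | always (φ : Desire A F)
  | eventually (φ : Desire A F)

/-- A fluent formula, viewed as a basic desire (a state desire). -/
def Desire.ofFluent {A F : Type*} : FluentFormula F → Desire A F
  | .lit l => .lit l
  | .and ψ₁ ψ₂ => .and (.ofFluent ψ₁) (.ofFluent ψ₂)
  | .or ψ₁ ψ₂ => .or (.ofFluent ψ₁) (.ofFluent ψ₂)
  | .neg ψ => .neg (.ofFluent ψ)

/-- `α ⊨ φ`. -/
def Desire.Sat {A F : Type*} : Desire A F → Trajectory A F → Prop
  | .goal ψ, α => ψ.Holds (α.state (Fin.last α.len))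
  | .lit l, α => l ∈ α.state 0
  | .occ a, α => ∃ h : 1 ≤ α.len, α.act ⟨0, h⟩ = a
  | .and φ₁ φ₂, α => φ₁.Sat α ∧ φ₂.Sat α
  | .or φ₁ φ₂, α => φ₁.Sat α ∨ φ₂.Sat α
  | .neg φ, α => ¬ φ.Sat α
  | .next φ, α => ∃ h : 1 ≤ α.len, φ.Sat (α.suffix 1 h)
  | .until φ₁ φ₂, α => ∃ (i : ℕ) (hi : i ≤ α.len),
      (∀ (j : ℕ) (hj : j < i), φ₁.Sat (α.suffix j (hj.le.trans hi))) ∧ φ₂.Sat (α.suffix i hi)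
  | .always φ, α => ∀ (i : ℕ) (hi : i ≤ α.len), φ.Sat (α.suffix i hi)
  | .eventually φ, α => ∃ (i : ℕ) (hi : i ≤ α.len), φ.Sat (α.suffix i hi)

/-- A fluent formula is satisfied by `α` exactly if it holds in the first state of `α`. -/
theorem Desire.sat_ofFluent {A F : Type*} (ψ : FluentFormula F) (α : Trajectory A F) :
    (Desire.ofFluent ψ : Desire A F).Sat α ↔ ψ.Holds (α.state 0) := by
  induction ψ with
  | lit l => rfl
  | and ψ₁ ψ₂ h₁ h₂ => simp only [Desire.ofFluent, Desire.Sat, FluentFormula.Holds, h₁, h₂]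
  | or ψ₁ ψ₂ h₁ h₂ => simp only [Desire.ofFluent, Desire.Sat, FluentFormula.Holds, h₁, h₂]
  | neg ψ h => simp only [Desire.ofFluent, Desire.Sat, FluentFormula.Holds, h]

/-- The connective `next` does not occur in the formula. -/
def Desire.NextFree {A F : Type*} : Desire A F → Prop
  | .goal _ => True
  | .lit _ => True
  | .occ _ => True
  | .and φ₁ φ₂ => φ₁.NextFree ∧ φ₂.NextFree
  | .or φ₁ φ₂ => φ₁.NextFree ∧ φ₂.NextFree
  | .neg φ => φ.NextFree
  | .next _ => False
  | .until φ₁ φ₂ => φ₁.NextFree ∧ φ₂.NextFree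
  | .always φ => φ.NextFree
  | .eventually φ => φ.NextFree

/-- `α ≺_φ β`: `α` is preferred to `β` with respect to `φ`. -/
def Preferred {A F : Type*} (φ : Desire A F) (α β : Trajectory A F) : Prop :=
  φ.Sat α ∧ ¬ φ.Sat β

/-- `α` is a most preferred trajectory with respect to `φ`. -/
def MostPreferred {A F : Type*} (D : Set (Law A F)) (φ : Desire A F) (α : Trajectory A F) : Prop :=
  α.IsTrajectory D ∧ ¬ ∃ β : Trajectory A F, β.IsTrajectory D ∧ Preferred φ β α

/-! ### The programs -/

/-- Ground atoms. The unique name `n_φ` of a basic desire `φ` is `φ` itself. -/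
inductive Atom (A F : Type*) where
  -- atoms of the planning program
  | literal (l : Literal F)
  | holds (l : Literal F) (t : ℕ)
  | possible (a : A) (t : ℕ)
  | occ (a : A) (t : ℕ)
  | nocc (a : A) (t : ℕ)
  -- a fluent formula holds at a time moment
  | h (ψ : FluentFormula F) (t : ℕ)
  -- atoms encoding basic desires
  | desire (n : Desire A F)
  | goal (n n₁ : Desire A F)
  | happen (n : Desire A F) (a : A)
  | and (n n₁ n₂ : Desire A F)
  | or (n n₁ n₂ : Desire A F)
  | negation (n n₁ : Desire A F)
  | next (n n₁ : Desire A F)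
  | until (n n₁ n₂ : Desire A F)
  | always (n n₁ : Desire A F)
  | eventually (n n₁ : Desire A F)
  -- atoms for satisfaction
  | satisfy (n : Desire A F) (t : ℕ)
  | during (n : Desire A F) (t t₁ : ℕ)

section
variable {A F : Type*}

/-- The ground rules of the planning program for `D` and `I`, with time moments `0, …, length`. -/
inductive PlanRule (D : Set (Law A F)) (I : Set (Literal F)) (length : ℕ) :
    Rule (Atom A F) → Prop
  | literal (l : Literal F) : PlanRule D I length (.fact (.literal l))
  | initially (l : Literal F) (hl : l ∈ I) : PlanRule D I length (.fact (.holds l 0))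
  | executable (a : A) (body : List (Literal F)) (t : ℕ)
      (hD : Law.executable a body ∈ D) (ht : t ≤ length) :
      PlanRule D I length ⟨some (.possible a t), body.map (fun p => .holds p t), []⟩
  | causes (a : A) (l : Literal F) (body : List (Literal F)) (t : ℕ)
      (hD : Law.causes a l body ∈ D) (ht : t < length) :
      PlanRule D I length
        ⟨some (.holds l (t + 1)), .occ a t :: body.map (fun p => .holds p t), []⟩
  | static (l : Literal F) (body : List (Literal F)) (t : ℕ)
      (hD : Law.static l body ∈ D) (ht : t ≤ length) :
      PlanRule D I length ⟨some (.holds l t), body.map (fun p => .holds p t), []⟩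
  | inertia (l : Literal F) (t : ℕ) (ht : t < length) :
      PlanRule D I length ⟨some (.holds l (t + 1)), [.holds l t], [.holds l.compl (t + 1)]⟩
  | consistent (f : F) (t : ℕ) (ht : t ≤ length) :
      PlanRule D I length ⟨none, [.holds (.pos f) t, .holds (.neg f) t], []⟩
  | generate (a : A) (t : ℕ) (ht : t < length) :
      PlanRule D I length ⟨some (.occ a t), [.possible a t], [.nocc a t]⟩
  | exclude (a b : A) (t : ℕ) (hab : a ≠ b) (ht : t < length) :
      PlanRule D I length ⟨some (.nocc a t), [.occ b t], []⟩

/-- The rules defining `h(ψ, t)` for a fluent formula and its subformulae. -/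
def formulaRules (length : ℕ) : FluentFormula F → Set (Rule (Atom A F))
  | .lit l => {r | ∃ t ≤ length, r = ⟨some (.h (.lit l) t), [.holds l t], []⟩}
  | .and ψ₁ ψ₂ => formulaRules length ψ₁ ∪ formulaRules length ψ₂ ∪
      {r | ∃ t ≤ length, r = ⟨some (.h (.and ψ₁ ψ₂) t), [.h ψ₁ t, .h ψ₂ t], []⟩}
  | .or ψ₁ ψ₂ => formulaRules length ψ₁ ∪ formulaRules length ψ₂ ∪
      {r | ∃ t ≤ length, r = ⟨some (.h (.or ψ₁ ψ₂) t), [.h ψ₁ t], []⟩ ∨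
        r = ⟨some (.h (.or ψ₁ ψ₂) t), [.h ψ₂ t], []⟩}
  | .neg ψ => formulaRules length ψ ∪
      {r | ∃ t ≤ length, r = ⟨some (.h (.neg ψ) t), [], [.h ψ t]⟩}

/-- The planning program `Π(D, I, G)` with maximal plan length `length`. Its last part is the
constraint that the goal holds at time `length`. -/
def planProgram (D : Set (Law A F)) (I : Set (Literal F)) (G : FluentFormula F) (length : ℕ) :
    Set (Rule (Atom A F)) :=
  {r | PlanRule D I length r} ∪ formulaRules length G ∪ {⟨none, [], [.h G length]⟩}

/-- The facts encoding a basic desire and its subformulae. -/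
def encode : Desire A F → Set (Atom A F)
  | .goal ψ => encodeFluent ψ ∪
      {.desire (.goal ψ), .goal (.goal ψ) (.ofFluent ψ)}
  | .lit l => {.desire (.lit l)}
  | .occ a => {.desire (.occ a), .happen (.occ a) a}
  | .and φ₁ φ₂ => encode φ₁ ∪ encode φ₂ ∪ {.desire (.and φ₁ φ₂), .and (.and φ₁ φ₂) φ₁ φ₂}
  | .or φ₁ φ₂ => encode φ₁ ∪ encode φ₂ ∪ {.desire (.or φ₁ φ₂), .or (.or φ₁ φ₂) φ₁ φ₂}
  | .neg φ => encode φ ∪ {.desire (.neg φ), .negation (.neg φ) φ}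
  | .next φ => encode φ ∪ {.desire (.next φ), .next (.next φ) φ}
  | .until φ₁ φ₂ => encode φ₁ ∪ encode φ₂ ∪
      {.desire (.until φ₁ φ₂), .until (.until φ₁ φ₂) φ₁ φ₂}
  | .always φ => encode φ ∪ {.desire (.always φ), .always (.always φ) φ}
  | .eventually φ => encode φ ∪ {.desire (.eventually φ), .eventually (.eventually φ) φ}
where
  /-- The same encoding for the fluent formula inside a goal preference. -/
  encodeFluent : FluentFormula F → Set (Atom A F)
    | .lit l => {.desire (.lit l)}
    | .and ψ₁ ψ₂ => encodeFluent ψ₁ ∪ encodeFluent ψ₂ ∪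
        {.desire (.ofFluent (.and ψ₁ ψ₂)),
          .and (.ofFluent (.and ψ₁ ψ₂)) (.ofFluent ψ₁) (.ofFluent ψ₂)}
    | .or ψ₁ ψ₂ => encodeFluent ψ₁ ∪ encodeFluent ψ₂ ∪
        {.desire (.ofFluent (.or ψ₁ ψ₂)),
          .or (.ofFluent (.or ψ₁ ψ₂)) (.ofFluent ψ₁) (.ofFluent ψ₂)}
    | .neg ψ => encodeFluent ψ ∪
        {.desire (.ofFluent (.neg ψ)), .negation (.ofFluent (.neg ψ)) (.ofFluent ψ)}

/-- The program `Π_φ`. -/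
def desireProgram (φ : Desire A F) : Set (Rule (Atom A F)) :=
  {r | ∃ a ∈ encode φ ∪ {a | ∃ l : Literal F, a = .desire (.lit l)}, r = .fact a}

/-- The ground rules of `Π_sat`; the time variables range over `0, …, length`. -/
inductive SatRule (length : ℕ) : Rule (Atom A F) → Prop
  | goal (n n₁ : Desire A F) (t : ℕ) (ht : t ≤ length) :
      SatRule length
        ⟨some (.satisfy n t), [.desire n, .goal n n₁, .satisfy n₁ length], []⟩
  | happen (n : Desire A F) (a : A) (t : ℕ) (ht : t ≤ length) :
      SatRule length ⟨some (.satisfy n t), [.desire n, .happen n a, .occ a t], []⟩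
  | literal (l : Literal F) (t : ℕ) (ht : t ≤ length) :
      SatRule length
        ⟨some (.satisfy (.lit l) t), [.desire (.lit l), .literal l, .holds l t], []⟩
  | and (n n₁ n₂ : Desire A F) (t : ℕ) (ht : t ≤ length) :
      SatRule length
        ⟨some (.satisfy n t), [.desire n, .and n n₁ n₂, .satisfy n₁ t, .satisfy n₂ t], []⟩
  | or_left (n n₁ n₂ : Desire A F) (t : ℕ) (ht : t ≤ length) :
      SatRule length ⟨some (.satisfy n t), [.desire n, .or n n₁ n₂, .satisfy n₁ t], []⟩
  | or_right (n n₁ n₂ : Desire A F) (t : ℕ) (ht : t ≤ length) :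
      SatRule length ⟨some (.satisfy n t), [.desire n, .or n n₁ n₂, .satisfy n₂ t], []⟩
  | negation (n n₁ : Desire A F) (t : ℕ) (ht : t ≤ length) :
      SatRule length ⟨some (.satisfy n t), [.desire n, .negation n n₁], [.satisfy n₁ t]⟩
  | until_later (n n₁ n₂ : Desire A F) (t t₁ : ℕ) (ht : t < t₁) (ht₁ : t₁ ≤ length) :
      SatRule length
        ⟨some (.satisfy n t),
          [.desire n, .until n n₁ n₂, .during n₁ t (t₁ - 1), .satisfy n₂ t₁], []⟩
  | until_now (n n₁ n₂ : Desire A F) (t : ℕ) (ht : t ≤ length) :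
      SatRule length ⟨some (.satisfy n t), [.desire n, .until n n₁ n₂, .satisfy n₂ t], []⟩
  | always (n n₁ : Desire A F) (t : ℕ) (ht : t ≤ length) :
      SatRule length ⟨some (.satisfy n t), [.desire n, .always n n₁, .during n₁ t length], []⟩
  | next (n n₁ : Desire A F) (t : ℕ) (ht : t ≤ length) :
      SatRule length ⟨some (.satisfy n t), [.desire n, .next n n₁, .satisfy n₁ (t + 1)], []⟩
  | eventually (n n₁ : Desire A F) (t t₁ : ℕ) (ht : t ≤ t₁) (ht₁ : t₁ ≤ length) :
      SatRule length ⟨some (.satisfy n t), [.desire n, .eventually n n₁, .satisfy n₁ t₁], []⟩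
  | during_step (n : Desire A F) (t t₁ : ℕ) (ht : t < t₁) (ht₁ : t₁ ≤ length) :
      SatRule length
        ⟨some (.during n t t₁), [.desire n, .satisfy n t, .during n (t + 1) t₁], []⟩
  | during_base (n : Desire A F) (t : ℕ) (ht : t ≤ length) :
      SatRule length ⟨some (.during n t t), [.desire n, .satisfy n t], []⟩

/-- The program `Π_sat`. -/
def satProgram (length : ℕ) : Set (Rule (Atom A F)) := {r | SatRule length r}

/-- The program `Π(D, I, G, φ) = Π(D, I, G) ∪ Π_φ ∪ Π_sat`. -/
def desirePlanProgram (D : Set (Law A F)) (I : Set (Literal F)) (G : FluentFormula F)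
    (length : ℕ) (φ : Desire A F) : Set (Rule (Atom A F)) :=
  planProgram D I G length ∪ desireProgram φ ∪ satProgram length

/-- `M` represents `α = s₀ a₁ … aₖ sₖ`: the time bound is respected, `sᵢ = {l | holds(l, i) ∈ M}`,
and the action occurrences recorded in `M` are exactly those of `α`. -/
def Represents (length : ℕ) (M : Set (Atom A F)) (α : Trajectory A F) : Prop :=
  α.len ≤ length ∧
    (∀ i : Fin (α.len + 1), α.state i = {l | Atom.holds l (i : ℕ) ∈ M}) ∧
    ∀ (a : A) (t : ℕ), Atom.occ a t ∈ M ↔ ∃ ht : t < α.len, α.act ⟨t, ht⟩ = a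

end

end PlanPref

namespace PlanPref

/-! ### Answer sets -/

section AnswerSets
variable {At : Type*} {P : Set (Rule At)} {M : Set At}

/-! An answer set is the least model of its own reduct. Hence it is closed under the rules
(`IsAnswerSet.mem_of_rule`), and each of its atoms is derived by some rule (`IsAnswerSet.induction`,
`IsAnswerSet.supported`).

For the sets `stateAt M t`, the rules give lower bounds and `stateAt_subset` the matching upper
bound. Consecutive states are therefore linked by the transition function if an action occurs, and
equal if none does. Before the time bound at most one action occurs at a time, and some action does
occur if one is executable. So after the first idle time the state is frozen and no action occurs
any more (`stateAt_eq_of_no_occ`): `M` describes a trajectory `α` followed by copies of its last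
state up to time `length`.

The core is `Represents.satisfy_mem_iff`, a structural induction showing that `satisfy(η, t)` means
truth of `η` at position `min t α.len` of `α`. The copies of the last state are invisible to every
construct except `next`, which is false at the end of `α` whereas the program evaluates its argument
in the next copy. This is why `α` must have full length or `next` must be absent. Finally, nothing
is preferred to a trajectory that satisfies `φ`, since preference requires it to violate `φ`. -/

theorem IsAnswerSet.exists_head (hM : IsAnswerSet P M) {r : Rule At} (hr : r ∈ P)
    (hpos : ∀ b ∈ r.pos, b ∈ M) (hneg : ∀ b ∈ r.neg, b ∉ M) : ∃ a, r.head = some a ∧ a ∈ M :=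
  hM.1 ⟨r.head, r.pos, []⟩ ⟨r, hr, hneg, rfl⟩ hpos (by simp)

theorem IsAnswerSet.mem_of_rule (hM : IsAnswerSet P M) {a : At} {pos neg : List At}
    (hr : ⟨some a, pos, neg⟩ ∈ P) (hpos : ∀ b ∈ pos, b ∈ M) (hneg : ∀ b ∈ neg, b ∉ M) :
    a ∈ M := by
  obtain ⟨a', ha', h⟩ := hM.exists_head hr hpos hneg
  cases ha'
  exact h

/-- The atoms of an answer set are derived by its rules, which yields an induction principle. -/
theorem IsAnswerSet.induction (hM : IsAnswerSet P M) (p : At → Prop)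
    (h : ∀ r ∈ P, ∀ a, r.head = some a → (∀ b ∈ r.pos, b ∈ M ∧ p b) →
      (∀ b ∈ r.neg, b ∉ M) → p a) {a : At} (ha : a ∈ M) : p a := by
  -- The atoms of `M` with property `p` form a model of the reduct, so leastness of `M` applies.
  have hsub : M ⊆ {a | a ∈ M ∧ p a} := hM.2 (by
    rintro _ ⟨r, hr, hneg, rfl⟩ hpos _
    obtain ⟨a, ha, haM⟩ := hM.exists_head hr (fun b hb => (hpos b hb).1) hneg
    exact ⟨a, ha, haM, h r hr a ha hpos hneg⟩)
  exact (hsub ha).2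

theorem IsAnswerSet.supported (hM : IsAnswerSet P M) {a : At} (ha : a ∈ M) :
    ∃ r ∈ P, r.head = some a ∧ (∀ b ∈ r.pos, b ∈ M) ∧ ∀ b ∈ r.neg, b ∉ M :=
  hM.induction (fun a => ∃ r ∈ P, r.head = some a ∧ (∀ b ∈ r.pos, b ∈ M) ∧ ∀ b ∈ r.neg, b ∉ M)
    (fun r hr _ ha hpos hneg => ⟨r, hr, ha, fun b hb => (hpos b hb).1, hneg⟩) ha

end AnswerSets

/-! ### States and trajectories -/

section Trajectories
variable {A F : Type*}

theorem IsState.compl_mem_iff {D : Set (Law A F)} {s : Set (Literal F)} (hs : IsState D s)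
    (l : Literal F) : l.compl ∈ s ↔ l ∉ s := by
  cases l with
  | pos f => have := hs.1 f; simp only [Literal.compl]; tauto
  | neg f => have := hs.1 f; simp only [Literal.compl]; tauto

/-- Complete consistent sets are maximal: a literal in `s'` but not in `s` has its complement in
`s`, hence also in `s'`. -/
theorem IsState.eq_of_subset {D : Set (Law A F)} {s s' : Set (Literal F)} (hs : IsState D s)
    (hs' : IsState D s') (h : s ⊆ s') : s = s' := by
  refine h.antisymm fun l hl => ?_
  by_contra hn
  exact (hs'.compl_mem_iff l).1 (h ((hs.compl_mem_iff l).2 hn)) hl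

theorem Trajectory.ext_of {α β : Trajectory A F} (hlen : α.len = β.len)
    (hstate : ∀ i (hi : i < α.len + 1) (hi' : i < β.len + 1), α.state ⟨i, hi⟩ = β.state ⟨i, hi'⟩)
    (hact : ∀ i (hi : i < α.len) (hi' : i < β.len), α.act ⟨i, hi⟩ = β.act ⟨i, hi'⟩) : α = β := by
  obtain ⟨n, s, a⟩ := α
  obtain ⟨m, s', a'⟩ := β
  obtain rfl : n = m := hlen
  congr
  · exact funext fun i => hstate i i.2 i.2
  · exact funext fun i => hact i i.2 i.2

theorem Trajectory.suffix_zero (α : Trajectory A F) : α.suffix 0 (Nat.zero_le _) = α :=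
  Trajectory.ext_of rfl (fun i _ _ => by simp [Trajectory.suffix])
    (fun i _ _ => by simp [Trajectory.suffix])

theorem Trajectory.suffix_suffix (α : Trajectory A F) {i j : ℕ} (hi : i ≤ α.len)
    (hj : j ≤ (α.suffix i hi).len) (hij : i + j ≤ α.len) :
    (α.suffix i hi).suffix j hj = α.suffix (i + j) hij :=
  Trajectory.ext_of (Nat.sub_sub _ _ _) (fun x _ _ => by simp [Trajectory.suffix, add_assoc])
    (fun x _ _ => by simp [Trajectory.suffix, add_assoc])

/-- `α[i] ⊨ φ`, where `i` is a position of `α`. -/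
def Desire.SatAt (φ : Desire A F) (α : Trajectory A F) (i : ℕ) : Prop :=
  ∃ hi : i ≤ α.len, φ.Sat (α.suffix i hi)

theorem Desire.satAt_zero (φ : Desire A F) (α : Trajectory A F) : φ.SatAt α 0 ↔ φ.Sat α := by
  simp [Desire.SatAt, Trajectory.suffix_zero]

theorem Desire.satAt_iff {φ : Desire A F} {α : Trajectory A F} {i : ℕ} (hi : i ≤ α.len) :
    φ.SatAt α i ↔ φ.Sat (α.suffix i hi) := by
  simp [Desire.SatAt, hi]

/-- This turns positions relative to a suffix into absolute positions of `α`, from which the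
characterizations of the temporal connectives follow. -/
theorem Desire.sat_suffix_suffix {φ : Desire A F} {α : Trajectory A F} {i j : ℕ}
    (hi : i ≤ α.len) (hj : j ≤ (α.suffix i hi).len) :
    φ.Sat ((α.suffix i hi).suffix j hj) ↔ φ.SatAt α (i + j) := by
  have hij : i + j ≤ α.len := by
    have : j ≤ α.len - i := hj
    omega
  rw [Desire.satAt_iff hij, Trajectory.suffix_suffix α hi hj hij]

theorem Desire.satAt_goal {ψ : FluentFormula F} {α : Trajectory A F} {i : ℕ} (hi : i ≤ α.len) :
    (Desire.goal ψ : Desire A F).SatAt α i ↔ ψ.Holds (α.state (Fin.last α.len)) := by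
  rw [Desire.satAt_iff hi]
  simp [Desire.Sat, Trajectory.suffix, Fin.last, hi]

theorem Desire.satAt_occ {a : A} {α : Trajectory A F} {i : ℕ} (hi : i ≤ α.len) :
    (Desire.occ a : Desire A F).SatAt α i ↔ ∃ h : i < α.len, α.act ⟨i, h⟩ = a := by
  rw [Desire.satAt_iff hi]
  constructor
  · rintro ⟨h, ha⟩
    have : 1 ≤ α.len - i := h
    exact ⟨by omega, ha⟩
  · rintro ⟨h, ha⟩
    exact ⟨show 1 ≤ α.len - i by omega, ha⟩

theorem Desire.satAt_next {φ : Desire A F} {α : Trajectory A F} {i : ℕ} (hi : i ≤ α.len) :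
    φ.next.SatAt α i ↔ φ.SatAt α (i + 1) := by
  rw [Desire.satAt_iff hi]
  constructor
  · rintro ⟨h, ha⟩
    exact (Desire.sat_suffix_suffix hi h).1 ha
  · rintro ⟨h, ha⟩
    have h' : 1 ≤ (α.suffix i hi).len := show 1 ≤ α.len - i by omega
    exact ⟨h', (Desire.sat_suffix_suffix hi h').2 ⟨h, ha⟩⟩

theorem Desire.satAt_always {φ : Desire A F} {α : Trajectory A F} {i : ℕ} (hi : i ≤ α.len) :
    φ.always.SatAt α i ↔ ∀ j, i ≤ j → j ≤ α.len → φ.SatAt α j := by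
  rw [Desire.satAt_iff hi]
  constructor
  · intro h j hij hj
    have h' : j - i ≤ (α.suffix i hi).len := show j - i ≤ α.len - i by omega
    have := (Desire.sat_suffix_suffix hi h').1 (h (j - i) h')
    rwa [Nat.add_sub_cancel' hij] at this
  · intro h j hj
    have h' : j ≤ α.len - i := hj
    exact (Desire.sat_suffix_suffix hi hj).2 (h _ (by omega) (by omega))

theorem Desire.satAt_eventually {φ : Desire A F} {α : Trajectory A F} {i : ℕ} (hi : i ≤ α.len) :
    φ.eventually.SatAt α i ↔ ∃ j, i ≤ j ∧ φ.SatAt α j := by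
  rw [Desire.satAt_iff hi]
  constructor
  · rintro ⟨j, hj, h⟩
    exact ⟨i + j, by omega, (Desire.sat_suffix_suffix hi hj).1 h⟩
  · rintro ⟨j, hij, h⟩
    have hj := h.1
    have h' : j - i ≤ (α.suffix i hi).len := show j - i ≤ α.len - i by omega
    refine ⟨j - i, h', (Desire.sat_suffix_suffix hi h').2 ?_⟩
    rwa [Nat.add_sub_cancel' hij]

theorem Desire.satAt_until {φ₁ φ₂ : Desire A F} {α : Trajectory A F} {i : ℕ} (hi : i ≤ α.len) :
    (φ₁.until φ₂).SatAt α i ↔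
      ∃ j, i ≤ j ∧ (∀ m, i ≤ m → m < j → φ₁.SatAt α m) ∧ φ₂.SatAt α j := by
  rw [Desire.satAt_iff hi]
  constructor
  · rintro ⟨j, hj, h₁, h₂⟩
    refine ⟨i + j, by omega, fun m him hm => ?_, (Desire.sat_suffix_suffix hi hj).1 h₂⟩
    have := (Desire.sat_suffix_suffix hi _).1 (h₁ (m - i) (by omega))
    rwa [Nat.add_sub_cancel' him] at this
  · rintro ⟨j, hij, h₁, h₂⟩
    have hj := h₂.1
    have h' : j - i ≤ (α.suffix i hi).len := show j - i ≤ α.len - i by omega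
    refine ⟨j - i, h', fun m hm => (Desire.sat_suffix_suffix hi _).2 (h₁ _ (by omega) (by omega)),
      (Desire.sat_suffix_suffix hi h').2 ?_⟩
    rwa [Nat.add_sub_cancel' hij]

end Trajectories

/-! ### The rules of the program, sorted by their heads -/

section Rules
variable {A F : Type*} {D : Set (Law A F)} {I : Set (Literal F)} {G : FluentFormula F}
  {length : ℕ} {φ : Desire A F}

theorem mem_desirePlanProgram_iff {r : Rule (Atom A F)} :
    r ∈ desirePlanProgram D I G length φ ↔
      PlanRule D I length r ∨ r ∈ formulaRules length G ∨ r = ⟨none, [], [.h G length]⟩ ∨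
        (∃ a ∈ encode φ, r = .fact a) ∨ (∃ l, r = .fact (.desire (.lit l))) ∨
        SatRule length r := by
  simp only [desirePlanProgram, planProgram, desireProgram, satProgram, Set.mem_union,
    Set.mem_ofPred_eq, Set.mem_singleton_iff]
  constructor
  · rintro ((((h | h) | h) | ⟨a, ha | ⟨l, rfl⟩, rfl⟩) | h)
    · exact .inl h
    · exact .inr (.inl h)
    · exact .inr (.inr (.inl h))
    · exact .inr (.inr (.inr (.inl ⟨a, ha, rfl⟩)))
    · exact .inr (.inr (.inr (.inr (.inl ⟨l, rfl⟩))))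
    · exact .inr (.inr (.inr (.inr (.inr h))))
  · rintro (h | h | h | ⟨a, ha, rfl⟩ | ⟨l, rfl⟩ | h)
    · exact .inl (.inl (.inl (.inl h)))
    · exact .inl (.inl (.inl (.inr h)))
    · exact .inl (.inl (.inr h))
    · exact .inl (.inr ⟨a, .inl ha, rfl⟩)
    · exact .inl (.inr ⟨_, .inr ⟨l, rfl⟩, rfl⟩)
    · exact .inr h

theorem PlanRule.mem {r : Rule (Atom A F)} (h : PlanRule D I length r) :
    r ∈ desirePlanProgram D I G length φ := mem_desirePlanProgram_iff.2 (.inl h)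

theorem SatRule.mem {r : Rule (Atom A F)} (h : SatRule length r) :
    r ∈ desirePlanProgram D I G length φ := by
  simp [mem_desirePlanProgram_iff, h]

/-- The bodies of the rules for `h(ψ, t)`. -/
def FormulaRuleFor (r : Rule (Atom A F)) (t : ℕ) : FluentFormula F → Prop
  | .lit l => r = ⟨some (.h (.lit l) t), [.holds l t], []⟩
  | .and ψ₁ ψ₂ => r = ⟨some (.h (.and ψ₁ ψ₂) t), [.h ψ₁ t, .h ψ₂ t], []⟩
  | .or ψ₁ ψ₂ => r = ⟨some (.h (.or ψ₁ ψ₂) t), [.h ψ₁ t], []⟩ ∨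
        r = ⟨some (.h (.or ψ₁ ψ₂) t), [.h ψ₂ t], []⟩
  | .neg ψ => r = ⟨some (.h (.neg ψ) t), [], [.h ψ t]⟩

theorem exists_formulaRuleFor {r : Rule (Atom A F)} (h : r ∈ formulaRules length G) :
    ∃ ψ t, r.head = some (.h ψ t) ∧ FormulaRuleFor r t ψ := by
  induction G with
  | lit l =>
    obtain ⟨t, _, rfl⟩ := h
    exact ⟨_, t, rfl, rfl⟩
  | and ψ₁ ψ₂ h₁ h₂ =>
    rcases h with (h | h) | ⟨t, _, rfl⟩
    · exact h₁ h
    · exact h₂ h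
    · exact ⟨_, t, rfl, rfl⟩
  | or ψ₁ ψ₂ h₁ h₂ =>
    rcases h with (h | h) | ⟨t, _, rfl | rfl⟩
    · exact h₁ h
    · exact h₂ h
    · exact ⟨_, t, rfl, .inl rfl⟩
    · exact ⟨_, t, rfl, .inr rfl⟩
  | neg ψ h₁ =>
    rcases h with h | ⟨t, _, rfl⟩
    · exact h₁ h
    · exact ⟨_, t, rfl, rfl⟩

/-- The atoms that may occur in the encoding of a basic desire. -/
def EncodesOperator : Atom A F → Prop
  | .desire _ => True
  | .goal n n₁ => ∃ ψ, n = .goal ψ ∧ n₁ = .ofFluent ψ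
  | .happen n a => n = .occ a
  | .and n n₁ n₂ => n = .and n₁ n₂
  | .or n n₁ n₂ => n = .or n₁ n₂
  | .negation n n₁ => n = .neg n₁
  | .next n n₁ => n = .next n₁
  | .until n n₁ n₂ => n = .until n₁ n₂
  | .always n n₁ => n = .always n₁
  | .eventually n n₁ => n = .eventually n₁
  | _ => False

theorem encodesOperator_of_mem_encodeFluent {ψ : FluentFormula F} {a : Atom A F}
    (h : a ∈ encode.encodeFluent ψ) : EncodesOperator a := by
  induction ψ with
  | lit l => obtain rfl := h; trivial
  | and ψ₁ ψ₂ h₁ h₂ =>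
    rcases h with (h | h) | rfl | rfl
    exacts [h₁ h, h₂ h, trivial, rfl]
  | or ψ₁ ψ₂ h₁ h₂ =>
    rcases h with (h | h) | rfl | rfl
    exacts [h₁ h, h₂ h, trivial, rfl]
  | neg ψ h₁ =>
    rcases h with h | rfl | rfl
    exacts [h₁ h, trivial, rfl]

/-- Names are the formulae themselves, so an operator fact determines the shape of its first
argument. This makes inversion of the `satisfy` rules possible. -/
theorem encodesOperator_of_mem_encode {a : Atom A F} (h : a ∈ encode φ) : EncodesOperator a := by
  induction φ with
  | goal ψ =>
    rcases h with h | rfl | rfl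
    exacts [encodesOperator_of_mem_encodeFluent h, trivial, ⟨ψ, rfl, rfl⟩]
  | lit l => obtain rfl := h; trivial
  | occ b =>
    rcases h with rfl | rfl
    exacts [trivial, rfl]
  | neg _ h₁ | next _ h₁ | always _ h₁ | eventually _ h₁ =>
    rcases h with h | rfl | rfl
    exacts [h₁ h, trivial, rfl]
  | _ _ _ h₁ h₂ =>
    rcases h with (h | h) | rfl | rfl
    exacts [h₁ h, h₂ h, trivial, rfl]

theorem encode_ofFluent (ψ : FluentFormula F) :
    encode (Desire.ofFluent ψ : Desire A F) = encode.encodeFluent ψ := by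
  induction ψ with
  | lit l => rfl
  | and ψ₁ ψ₂ h₁ h₂ => simp only [Desire.ofFluent, encode, encode.encodeFluent, h₁, h₂]
  | or ψ₁ ψ₂ h₁ h₂ => simp only [Desire.ofFluent, encode, encode.encodeFluent, h₁, h₂]
  | neg ψ h => simp only [Desire.ofFluent, encode, encode.encodeFluent, h]

theorem desire_mem_encode (φ : Desire A F) : Atom.desire φ ∈ encode φ := by
  cases φ <;> simp [encode]

end Rules

/-! ### Answer sets of the program -/

section Program
variable {A F : Type*} {D : Set (Law A F)} {I : Set (Literal F)} {G : FluentFormula F}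
  {length : ℕ} {φ : Desire A F} {M : Set (Atom A F)}

/-- The literals that hold at time `t` according to `M`. -/
def stateAt (M : Set (Atom A F)) (t : ℕ) : Set (Literal F) := {l | Atom.holds l t ∈ M}

@[simp]
theorem mem_stateAt {l : Literal F} {t : ℕ} : l ∈ stateAt M t ↔ Atom.holds l t ∈ M := Iff.rfl

theorem rule_of_head_holds {r : Rule (Atom A F)} {l : Literal F} {t : ℕ}
    (hr : r ∈ desirePlanProgram D I G length φ) (hh : r.head = some (.holds l t)) :
    (t = 0 ∧ l ∈ I) ∨
    (∃ body, Law.static l body ∈ D ∧ r.pos = body.map (fun p => .holds p t)) ∨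
    (∃ a body t', t = t' + 1 ∧ Law.causes a l body ∈ D ∧
      r.pos = .occ a t' :: body.map (fun p => .holds p t')) ∨
    (∃ t', t = t' + 1 ∧ r.pos = [.holds l t'] ∧ r.neg = [.holds l.compl t]) := by
  rcases mem_desirePlanProgram_iff.1 hr with h | h | rfl | ⟨a, ha, rfl⟩ | ⟨l, rfl⟩ | h
  · cases h <;> simp [Rule.fact] at hh
    case initially l' hl => obtain ⟨rfl, rfl⟩ := hh; exact .inl ⟨rfl, hl⟩
    case causes a l body t' hD ht =>
      obtain ⟨rfl, rfl⟩ := hh; exact .inr (.inr (.inl ⟨a, body, t', rfl, hD, rfl⟩))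
    case static l body t hD ht => obtain ⟨rfl, rfl⟩ := hh; exact .inr (.inl ⟨body, hD, rfl⟩)
    case inertia l t' ht =>
      obtain ⟨rfl, rfl⟩ := hh; exact .inr (.inr (.inr ⟨t', rfl, rfl, rfl⟩))
  · obtain ⟨ψ, t', h', -⟩ := exists_formulaRuleFor h
    simp [hh] at h'
  · simp at hh
  · have := encodesOperator_of_mem_encode ha
    obtain rfl : a = _ := by simpa [Rule.fact] using hh
    exact this.elim
  · simp [Rule.fact] at hh
  · cases h <;> simp at hh

/-- The upper bound that minimality of `M` provides: a literal holds only through an initial fact, a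
causal law, inertia or a static law. Only the static laws stay within time `t`, so only they need
the induction hypothesis. -/
theorem stateAt_subset (hM : IsAnswerSet (desirePlanProgram D I G length φ) M) {t : ℕ}
    {u : Set (Literal F)} (hu : StaticClosed D u) (hI : t = 0 → I ⊆ u)
    (hE : ∀ a t', t = t' + 1 → Atom.occ a t' ∈ M → directEffects D a (stateAt M t') ⊆ u)
    (hin : ∀ t', t = t' + 1 → ∀ l ∈ stateAt M t', l.compl ∉ stateAt M t → l ∈ u) :
    stateAt M t ⊆ u := by
  intro l hl
  refine hM.induction (fun a => ∀ l, a = .holds l t → l ∈ u) ?_ hl l rfl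
  rintro r hr _ hh hpos hneg l rfl
  rcases rule_of_head_holds hr hh with
    ⟨h0, hl⟩ | ⟨body, hD, hb⟩ | ⟨a, body, t', ht, hD, hb⟩ | ⟨t', ht, hb, hn⟩
  · exact hI h0 hl
  · refine hu l body hD fun p hp => (hpos (.holds p t) ?_).2 p rfl
    rw [hb]
    exact List.mem_map_of_mem hp
  · rw [hb] at hpos
    refine hE a t' ht (hpos _ (by simp)).1 ⟨body, hD, fun p hp => (hpos (.holds p t') ?_).1⟩
    exact List.mem_cons_of_mem _ (List.mem_map_of_mem hp)
  · exact hin t' ht l (hpos _ (by simp [hb])).1 (hneg _ (by simp [hn]))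

theorem staticClosed_stateAt (hM : IsAnswerSet (desirePlanProgram D I G length φ) M) {t : ℕ}
    (ht : t ≤ length) : StaticClosed D (stateAt M t) := by
  intro l body hD hp
  refine hM.mem_of_rule (PlanRule.static l body t hD ht).mem ?_ (by simp)
  simpa using hp

theorem stateAt_consistent (hM : IsAnswerSet (desirePlanProgram D I G length φ) M) {t : ℕ}
    (ht : t ≤ length) (f : F) :
    ¬ (Literal.pos f ∈ stateAt M t ∧ Literal.neg f ∈ stateAt M t) := by
  rintro ⟨h₁, h₂⟩
  obtain ⟨a, ha, -⟩ := hM.exists_head (PlanRule.consistent f t ht).mem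
    (by simpa using ⟨h₁, h₂⟩) (by simp)
  simp at ha

theorem stateAt_zero (hM : IsAnswerSet (desirePlanProgram D I G length φ) M)
    (hI : IsState D I) : stateAt M 0 = I := by
  refine Set.Subset.antisymm ?_ fun l hl =>
    hM.mem_of_rule (PlanRule.initially l hl).mem (by simp) (by simp)
  exact stateAt_subset hM hI.2 (fun _ => subset_rfl) (fun _ _ h => by omega)
    (fun _ h => by omega)

theorem stateAt_inertia (hM : IsAnswerSet (desirePlanProgram D I G length φ) M) {t : ℕ}
    (ht : t < length) {l : Literal F} (hl : l ∈ stateAt M t)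
    (hc : l.compl ∉ stateAt M (t + 1)) : l ∈ stateAt M (t + 1) :=
  hM.mem_of_rule (PlanRule.inertia l t ht).mem (by simpa using hl) (by simpa using hc)

theorem isState_stateAt (hM : IsAnswerSet (desirePlanProgram D I G length φ) M)
    (hI : IsState D I) {t : ℕ} (ht : t ≤ length) : IsState D (stateAt M t) := by
  induction t with
  | zero => rwa [stateAt_zero hM hI]
  | succ t ih =>
    have ih := ih (by omega)
    refine ⟨fun f => ⟨?_, stateAt_consistent hM ht f⟩, staticClosed_stateAt hM ht⟩
    -- If neither literal of `f` held at `t + 1`, inertia would carry over the one that held at `t`.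
    by_contra! h
    rcases (ih.1 f).1 with hf | hf
    · exact h.1 (stateAt_inertia hM ht hf h.2)
    · exact h.2 (stateAt_inertia hM ht hf h.1)

theorem directEffects_subset_stateAt (hM : IsAnswerSet (desirePlanProgram D I G length φ) M)
    {t : ℕ} (ht : t < length) {a : A} (ha : Atom.occ a t ∈ M) :
    directEffects D a (stateAt M t) ⊆ stateAt M (t + 1) := by
  rintro l ⟨body, hD, hb⟩
  refine hM.mem_of_rule (PlanRule.causes a l body t hD ht).mem ?_ (by simp)
  simpa using ⟨ha, hb⟩

/-! ### Action occurrences and the transition function -/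

theorem occ_supported (hM : IsAnswerSet (desirePlanProgram D I G length φ) M) {a : A} {t : ℕ}
    (ha : Atom.occ a t ∈ M) :
    t < length ∧ Atom.possible a t ∈ M ∧ Atom.nocc a t ∉ M := by
  obtain ⟨r, hr, hh, hpos, hneg⟩ := hM.supported ha
  rcases mem_desirePlanProgram_iff.1 hr with h | h | rfl | ⟨a, ha, rfl⟩ | ⟨l, rfl⟩ | h
  · cases h <;> simp [Rule.fact] at hh
    obtain ⟨rfl, rfl⟩ := hh
    exact ⟨‹_›, hpos _ (by simp), hneg _ (by simp)⟩
  · obtain ⟨ψ, t', h', -⟩ := exists_formulaRuleFor h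
    simp [hh] at h'
  · simp at hh
  · have := encodesOperator_of_mem_encode ha
    obtain rfl : a = _ := by simpa [Rule.fact] using hh
    exact this.elim
  · simp [Rule.fact] at hh
  · cases h <;> simp at hh

theorem nocc_supported (hM : IsAnswerSet (desirePlanProgram D I G length φ) M) {a : A} {t : ℕ}
    (ha : Atom.nocc a t ∈ M) : ∃ b, Atom.occ b t ∈ M := by
  obtain ⟨r, hr, hh, hpos, hneg⟩ := hM.supported ha
  rcases mem_desirePlanProgram_iff.1 hr with h | h | rfl | ⟨a, ha, rfl⟩ | ⟨l, rfl⟩ | h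
  · cases h <;> simp [Rule.fact] at hh
    obtain ⟨-, rfl⟩ := hh
    exact ⟨_, hpos _ (List.mem_singleton_self _)⟩
  · obtain ⟨ψ, t', h', -⟩ := exists_formulaRuleFor h
    simp [hh] at h'
  · simp at hh
  · have := encodesOperator_of_mem_encode ha
    obtain rfl : a = _ := by simpa [Rule.fact] using hh
    exact this.elim
  · simp [Rule.fact] at hh
  · cases h <;> simp at hh

theorem executable_of_possible_mem (hM : IsAnswerSet (desirePlanProgram D I G length φ) M)
    {a : A} {t : ℕ} (ha : Atom.possible a t ∈ M) : Executable D a (stateAt M t) := by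
  obtain ⟨r, hr, hh, hpos, hneg⟩ := hM.supported ha
  rcases mem_desirePlanProgram_iff.1 hr with h | h | rfl | ⟨a, ha, rfl⟩ | ⟨l, rfl⟩ | h
  · cases h <;> simp [Rule.fact] at hh
    obtain ⟨rfl, rfl⟩ := hh
    exact ⟨_, ‹_›, by simpa using hpos⟩
  · obtain ⟨ψ, t', h', -⟩ := exists_formulaRuleFor h
    simp [hh] at h'
  · simp at hh
  · have := encodesOperator_of_mem_encode ha
    obtain rfl : a = _ := by simpa [Rule.fact] using hh
    exact this.elim
  · simp [Rule.fact] at hh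
  · cases h <;> simp at hh

theorem occ_unique (hM : IsAnswerSet (desirePlanProgram D I G length φ) M) {a b : A} {t : ℕ}
    (ha : Atom.occ a t ∈ M) (hb : Atom.occ b t ∈ M) : a = b := by
  by_contra hab
  obtain ⟨ht, -, hn⟩ := occ_supported hM ha
  exact hn (hM.mem_of_rule (PlanRule.exclude a b t hab ht).mem (by simpa using hb) (by simp))

/-- A possible action occurs unless it is blocked by `nocc`, and `nocc` is supported only by the
occurrence of some action. -/
theorem not_executable_of_no_occ (hM : IsAnswerSet (desirePlanProgram D I G length φ) M)
    {t : ℕ} (ht : t < length) (h : ∀ a, Atom.occ a t ∉ M) (a : A) :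
    ¬ Executable D a (stateAt M t) := by
  rintro ⟨body, hD, hb⟩
  have hp : Atom.possible a t ∈ M :=
    hM.mem_of_rule (PlanRule.executable a body t hD ht.le).mem (by simpa using hb) (by simp)
  refine h a (hM.mem_of_rule (PlanRule.generate a t ht).mem (by simpa using hp) ?_)
  rintro b hb hbM
  obtain rfl : b = _ := by simpa using hb
  obtain ⟨c, hc⟩ := nocc_supported hM hbM
  exact h c hc

theorem stateAt_succ_mem_transition (hM : IsAnswerSet (desirePlanProgram D I G length φ) M)
    (hI : IsState D I) {a : A} {t : ℕ} (ha : Atom.occ a t ∈ M) :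
    stateAt M (t + 1) ∈ transition D a (stateAt M t) := by
  obtain ⟨ht, hp, -⟩ := occ_supported hM ha
  have hs := isState_stateAt hM hI (t := t + 1) ht
  refine ⟨executable_of_possible_mem hM hp, hs, Set.Subset.antisymm ?_ ?_⟩
  -- The closure is an intersection, so the upper bound is applied to each closed superset `v`
  -- separately.
  · rintro l hl v ⟨huv, hv⟩
    refine stateAt_subset hM hv (fun h => by omega) ?_ ?_ hl
    · intro b t' ht' hb
      obtain rfl : t = t' := by omega
      rw [occ_unique hM hb ha]
      exact Set.subset_union_left.trans huv
    · intro t' ht' l hl hc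
      obtain rfl : t = t' := by omega
      -- A literal preserved by inertia lies in both states, hence in the part `s ∩ s'` of the
      -- generating set.
      exact huv (.inr ⟨hl, stateAt_inertia hM ht hl hc⟩)
  · exact Set.sInter_subset_of_mem ⟨Set.union_subset (directEffects_subset_stateAt hM ht ha)
      Set.inter_subset_right, hs.2⟩

/-- Without direct effects the old state is itself an admissible upper bound for the new one, and an
inclusion between states is an equality. -/
theorem stateAt_succ_of_no_occ (hM : IsAnswerSet (desirePlanProgram D I G length φ) M)
    (hI : IsState D I) {t : ℕ} (ht : t < length) (h : ∀ a, Atom.occ a t ∉ M) :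
    stateAt M (t + 1) = stateAt M t := by
  have hs := isState_stateAt hM hI ht.le
  refine (isState_stateAt hM hI (t := t + 1) ht).eq_of_subset hs ?_
  refine stateAt_subset hM hs.2 (fun h => by omega) ?_ ?_
  · intro b t' ht' hb
    obtain rfl : t = t' := by omega
    exact (h b hb).elim
  · intro t' ht' l hl _
    obtain rfl : t = t' := by omega
    exact hl

/-- Once no action occurs, nothing changes any more and no action occurs later. -/
theorem stateAt_eq_of_no_occ (hM : IsAnswerSet (desirePlanProgram D I G length φ) M)
    (hI : IsState D I) {k : ℕ} (h : ∀ a, Atom.occ a k ∉ M) {t : ℕ} (hkt : k ≤ t)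
    (ht : t ≤ length) : stateAt M t = stateAt M k ∧ ∀ a, Atom.occ a t ∉ M := by
  induction t, hkt using Nat.le_induction with
  | base => exact ⟨rfl, h⟩
  | succ t hkt ih =>
    obtain ⟨ih₁, ih₂⟩ := ih (by omega)
    have hs := stateAt_succ_of_no_occ hM hI ht ih₂
    refine ⟨hs.trans ih₁, fun a ha => ?_⟩
    have hx := executable_of_possible_mem hM (occ_supported hM ha).2.1
    rw [hs] at hx
    exact not_executable_of_no_occ hM ht ih₂ a hx

/-! ### The trajectory represented by an answer set -/

theorem exists_represents (hM : IsAnswerSet (desirePlanProgram D I G length φ) M)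
    (hI : IsState D I) : ∃ α : Trajectory A F, Represents length M α := by
  classical
  -- The length of the trajectory is the first idle time; `length` is always idle because actions
  -- are generated only before it.
  have hex : ∃ t, ∀ a, Atom.occ a t ∉ M := ⟨length, fun a ha => (occ_supported hM ha).1.false⟩
  have hk := Nat.find_spec hex
  have hlt : ∀ t < Nat.find hex, ∃ a, Atom.occ a t ∈ M := fun t ht => by
    simpa using Nat.find_min hex ht
  choose act hact using fun i : Fin (Nat.find hex) => hlt i i.2
  refine ⟨⟨Nat.find hex, fun i => stateAt M i, act⟩,
    Nat.find_min' hex fun a ha => (occ_supported hM ha).1.false, fun i => rfl, fun a t => ?_⟩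
  constructor
  · intro ha
    have ht : t < Nat.find hex := by
      by_contra! ht
      exact (stateAt_eq_of_no_occ hM hI hk ht (occ_supported hM ha).1.le).2 a ha
    exact ⟨ht, occ_unique hM (hact ⟨t, ht⟩) ha⟩
  · rintro ⟨ht, rfl⟩
    exact hact ⟨t, ht⟩

theorem Represents.unique {α β : Trajectory A F} (hα : Represents length M α)
    (hβ : Represents length M β) : β = α := by
  have hle : ∀ {α β : Trajectory A F}, Represents length M α → Represents length M β →
      α.len ≤ β.len := by
    intro α β hα hβ
    by_contra! h
    -- If `α` were longer, its action at time `β.len` would be in `M` and hence an action of `β`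
    -- past its end.
    exact ((hβ.2.2 _ _).1 ((hα.2.2 _ _).2 ⟨h, rfl⟩)).1.false
  refine Trajectory.ext_of ((hle hβ hα).antisymm (hle hα hβ)) (fun i hi hi' => ?_)
    fun i hi hi' => ?_
  · rw [hα.2.1, hβ.2.1]
  · obtain ⟨_, h⟩ := (hα.2.2 _ _).1 ((hβ.2.2 _ i).2 ⟨hi, rfl⟩)
    exact h.symm

theorem Represents.isTrajectory (hM : IsAnswerSet (desirePlanProgram D I G length φ) M)
    (hI : IsState D I) {α : Trajectory A F} (hα : Represents length M α) :
    α.IsTrajectory D := by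
  have hs : ∀ i, α.state i = stateAt M i := hα.2.1
  refine ⟨fun i => ?_, fun i => ?_⟩
  · rw [hs]
    exact isState_stateAt hM hI (by have := hα.1; omega)
  · rw [hs, hs]
    exact stateAt_succ_mem_transition hM hI ((hα.2.2 _ i).2 ⟨i.2, rfl⟩)

/-- The state at time `t` is the one that `α` has reached by then. -/
theorem Represents.stateAt_eq (hM : IsAnswerSet (desirePlanProgram D I G length φ) M)
    (hI : IsState D I) {α : Trajectory A F} (hα : Represents length M α) {t : ℕ}
    (ht : t ≤ length) : stateAt M t = stateAt M (min t α.len) := by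
  rcases le_total t α.len with h | h
  · rw [min_eq_left h]
  · rw [min_eq_right h]
    refine (stateAt_eq_of_no_occ hM hI (fun a ha => ?_) h ht).1
    exact ((hα.2.2 _ _).1 ha).1.false

/-! ### The goal -/

theorem h_supported (hM : IsAnswerSet (desirePlanProgram D I G length φ) M)
    {ψ : FluentFormula F} {t : ℕ} (h : Atom.h ψ t ∈ M) :
    ∃ r, FormulaRuleFor r t ψ ∧ (∀ b ∈ r.pos, b ∈ M) ∧ ∀ b ∈ r.neg, b ∉ M := by
  obtain ⟨r, hr, hh, hpos, hneg⟩ := hM.supported h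
  rcases mem_desirePlanProgram_iff.1 hr with h | h | rfl | ⟨a, ha, rfl⟩ | ⟨l, rfl⟩ | h
  · cases h <;> simp [Rule.fact] at hh
  · obtain ⟨ψ', t', h', hf⟩ := exists_formulaRuleFor h
    rw [hh] at h'
    simp only [Option.some.injEq, Atom.h.injEq] at h'
    obtain ⟨rfl, rfl⟩ := h'
    exact ⟨r, hf, hpos, hneg⟩
  · simp at hh
  · have := encodesOperator_of_mem_encode ha
    obtain rfl : a = _ := by simpa [Rule.fact] using hh
    exact this.elim
  · simp [Rule.fact] at hh
  · cases h <;> simp at hh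

/-- The rules for `ψ` are required only to be contained in the program, so that the hypothesis
passes to subformulae. -/
theorem h_mem_iff (hM : IsAnswerSet (desirePlanProgram D I G length φ) M)
    {ψ : FluentFormula F} (hψ : formulaRules length ψ ⊆ desirePlanProgram D I G length φ)
    {t : ℕ} (ht : t ≤ length) : Atom.h ψ t ∈ M ↔ ψ.Holds (stateAt M t) := by
  induction ψ with
  | lit l =>
    constructor
    · intro h
      obtain ⟨r, rfl, hpos, -⟩ := h_supported hM h
      exact hpos _ (by simp)
    · intro h
      exact hM.mem_of_rule (hψ ⟨t, ht, rfl⟩) (by simpa [FluentFormula.Holds] using h) (by simp)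
  | and ψ₁ ψ₂ h₁ h₂ =>
    rw [FluentFormula.Holds, ← h₁ fun r hr => hψ (.inl (.inl hr)),
      ← h₂ fun r hr => hψ (.inl (.inr hr))]
    constructor
    · intro h
      obtain ⟨r, rfl, hpos, -⟩ := h_supported hM h
      exact ⟨hpos _ (by simp), hpos _ (by simp)⟩
    · intro h
      exact hM.mem_of_rule (hψ (.inr ⟨t, ht, rfl⟩)) (by simpa using h) (by simp)
  | or ψ₁ ψ₂ h₁ h₂ =>
    rw [FluentFormula.Holds, ← h₁ fun r hr => hψ (.inl (.inl hr)),
      ← h₂ fun r hr => hψ (.inl (.inr hr))]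
    constructor
    · intro h
      obtain ⟨r, rfl | rfl, hpos, -⟩ := h_supported hM h
      exacts [.inl (hpos _ (by simp)), .inr (hpos _ (by simp))]
    · rintro (h | h)
      · exact hM.mem_of_rule (hψ (.inr ⟨t, ht, .inl rfl⟩)) (by simpa using h) (by simp)
      · exact hM.mem_of_rule (hψ (.inr ⟨t, ht, .inr rfl⟩)) (by simpa using h) (by simp)
  | neg ψ h₁ =>
    rw [FluentFormula.Holds, ← h₁ fun r hr => hψ (.inl hr)]
    constructor
    · intro h
      obtain ⟨r, rfl, -, hneg⟩ := h_supported hM h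
      exact hneg _ (by simp)
    · intro h
      exact hM.mem_of_rule (hψ (.inr ⟨t, ht, rfl⟩)) (by simp) (by simpa using h)

theorem goal_holds (hM : IsAnswerSet (desirePlanProgram D I G length φ) M) :
    G.Holds (stateAt M length) := by
  rw [← h_mem_iff hM (fun r hr => mem_desirePlanProgram_iff.2 (.inr (.inl hr))) le_rfl]
  by_contra h
  obtain ⟨a, ha, -⟩ := hM.exists_head (r := ⟨none, [], [.h G length]⟩)
    (mem_desirePlanProgram_iff.2 (.inr (.inr (.inl rfl)))) (by simp) (by simpa using h)
  simp at ha

theorem Represents.achieves (hM : IsAnswerSet (desirePlanProgram D I G length φ) M)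
    (hI : IsState D I) {α : Trajectory A F} (hα : Represents length M α) :
    α.Achieves I G := by
  have hs : ∀ i, α.state i = stateAt M i := hα.2.1
  refine ⟨fun l hl => ?_, ?_⟩
  · rw [hs]
    change l ∈ stateAt M 0
    rwa [stateAt_zero hM hI]
  · have := goal_holds hM
    rw [hα.stateAt_eq hM hI le_rfl, min_eq_right hα.1] at this
    rwa [hs]

/-! ### Satisfaction of basic desires -/

theorem mem_of_mem_encode (hM : IsAnswerSet (desirePlanProgram D I G length φ) M) {a : Atom A F}
    (ha : a ∈ encode φ) : a ∈ M :=
  hM.mem_of_rule (mem_desirePlanProgram_iff.2 (.inr (.inr (.inr (.inl ⟨a, ha, rfl⟩)))))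
    (by simp) (by simp)

/-- The atoms describing the outermost operator of a basic desire. -/
def IsOperatorAtom : Atom A F → Prop
  | .goal .. | .happen .. | .and .. | .or .. | .negation .. | .next .. | .until .. | .always ..
  | .eventually .. => True
  | _ => False

theorem encodesOperator_of_mem (hM : IsAnswerSet (desirePlanProgram D I G length φ) M)
    {a : Atom A F} (ha : a ∈ M) (hop : IsOperatorAtom a) : EncodesOperator a := by
  obtain ⟨r, hr, hh, -, -⟩ := hM.supported ha
  rcases mem_desirePlanProgram_iff.1 hr with h | h | rfl | ⟨b, hb, rfl⟩ | ⟨l, rfl⟩ | h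
  · cases h <;> cases hh <;> exact hop.elim
  · obtain ⟨ψ, t', h', -⟩ := exists_formulaRuleFor h
    rw [h'] at hh
    cases hh
    exact hop.elim
  · cases hh
  · cases hh
    exact encodesOperator_of_mem_encode hb
  · cases hh
    exact hop.elim
  · cases h <;> cases hh <;> exact hop.elim

/-- The disjunction of the bodies of the rules for `satisfy(η, t)`, without the atoms that
encode `η`. -/
def SatisfyBody (M : Set (Atom A F)) (length t : ℕ) : Desire A F → Prop
  | .goal ψ => Atom.satisfy (.ofFluent ψ) length ∈ M
  | .lit l => Atom.holds l t ∈ M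
  | .occ a => Atom.occ a t ∈ M
  | .and φ₁ φ₂ => Atom.satisfy φ₁ t ∈ M ∧ Atom.satisfy φ₂ t ∈ M
  | .or φ₁ φ₂ => Atom.satisfy φ₁ t ∈ M ∨ Atom.satisfy φ₂ t ∈ M
  | .neg φ => Atom.satisfy φ t ∉ M
  | .next φ => Atom.satisfy φ (t + 1) ∈ M
  | .until φ₁ φ₂ => Atom.satisfy φ₂ t ∈ M ∨ ∃ t₁, t < t₁ ∧ t₁ ≤ length ∧
      Atom.during φ₁ t (t₁ - 1) ∈ M ∧ Atom.satisfy φ₂ t₁ ∈ M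
  | .always φ => Atom.during φ t length ∈ M
  | .eventually φ => ∃ t₁, t ≤ t₁ ∧ t₁ ≤ length ∧ Atom.satisfy φ t₁ ∈ M

/-- The bound on `t` is part of the conclusion because the rule for `next` refers to `t + 1`, which
may exceed `length`. -/
theorem satisfy_supported (hM : IsAnswerSet (desirePlanProgram D I G length φ) M)
    {η : Desire A F} {t : ℕ} (h : Atom.satisfy η t ∈ M) :
    t ≤ length ∧ SatisfyBody M length t η := by
  obtain ⟨r, hr, hh, hpos, hneg⟩ := hM.supported h
  rcases mem_desirePlanProgram_iff.1 hr with h | h | rfl | ⟨a, ha, rfl⟩ | ⟨l, rfl⟩ | h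
  · cases h <;> cases hh
  · obtain ⟨ψ, t', h', -⟩ := exists_formulaRuleFor h
    rw [h'] at hh
    cases hh
  · cases hh
  · cases hh
    exact (encodesOperator_of_mem_encode ha).elim
  · cases hh
  · have henc : ∀ b ∈ r.pos, IsOperatorAtom b → EncodesOperator b := fun b hb hop =>
      encodesOperator_of_mem hM (hpos b hb) hop
    cases h <;> cases hh <;> simp only [List.mem_cons, List.not_mem_nil, or_false, forall_eq_or_imp,
      forall_eq, IsOperatorAtom, forall_true_left, true_and, false_imp_iff, and_true,
      EncodesOperator] at hpos hneg henc
    case goal.refl n₁ ht => obtain ⟨ψ, rfl, rfl⟩ := henc; exact ⟨ht, hpos.2.2⟩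
    case happen.refl a ht => subst henc; exact ⟨ht, hpos.2.2⟩
    case literal.refl l ht => exact ⟨ht, hpos.2.2⟩
    case and.refl n₁ n₂ ht => subst henc; exact ⟨ht, hpos.2.2⟩
    case or_left.refl n₁ n₂ ht => subst henc; exact ⟨ht, .inl hpos.2.2⟩
    case or_right.refl n₁ n₂ ht => subst henc; exact ⟨ht, .inr hpos.2.2⟩
    case negation.refl n₁ ht => subst henc; exact ⟨ht, hneg⟩
    case until_later.refl n₁ n₂ t₁ ht₁ ht =>
      subst henc; exact ⟨by omega, .inr ⟨t₁, by omega, by omega, hpos.2.2⟩⟩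
    case until_now.refl n₁ n₂ ht => subst henc; exact ⟨ht, .inl hpos.2.2⟩
    case always.refl n₁ ht => subst henc; exact ⟨ht, hpos.2.2⟩
    case next.refl n₁ ht => subst henc; exact ⟨ht, hpos.2.2⟩
    case eventually.refl n₁ t₁ ht₁ ht =>
      subst henc; exact ⟨by omega, t₁, by omega, by omega, hpos.2.2⟩

theorem satisfy_mem_iff (hM : IsAnswerSet (desirePlanProgram D I G length φ) M)
    {η : Desire A F} (hη : encode η ⊆ M) {t : ℕ} (ht : t ≤ length) :
    Atom.satisfy η t ∈ M ↔ SatisfyBody M length t η := by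
  refine ⟨fun h => (satisfy_supported hM h).2, fun h => ?_⟩
  have hd := hη (desire_mem_encode η)
  cases η with
  | goal ψ =>
    exact hM.mem_of_rule (SatRule.goal _ _ t ht).mem
      (by simpa using ⟨hd, hη (by simp [encode]), h⟩) (by simp)
  | lit l =>
    have hl : Atom.literal l ∈ M := hM.mem_of_rule (PlanRule.literal l).mem (by simp) (by simp)
    exact hM.mem_of_rule (SatRule.literal l t ht).mem (by simpa using ⟨hd, hl, h⟩) (by simp)
  | occ a =>
    exact hM.mem_of_rule (SatRule.happen _ a t ht).mem
      (by simpa using ⟨hd, hη (by simp [encode]), h⟩) (by simp)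
  | and φ₁ φ₂ =>
    exact hM.mem_of_rule (SatRule.and _ φ₁ φ₂ t ht).mem
      (by simpa using ⟨hd, hη (by simp [encode]), h⟩) (by simp)
  | or φ₁ φ₂ =>
    rcases h with h | h
    · exact hM.mem_of_rule (SatRule.or_left _ φ₁ φ₂ t ht).mem
        (by simpa using ⟨hd, hη (by simp [encode]), h⟩) (by simp)
    · exact hM.mem_of_rule (SatRule.or_right _ φ₁ φ₂ t ht).mem
        (by simpa using ⟨hd, hη (by simp [encode]), h⟩) (by simp)
  | neg φ₁ =>
    exact hM.mem_of_rule (SatRule.negation _ φ₁ t ht).mem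
      (by simpa using ⟨hd, hη (by simp [encode])⟩) (by simpa [SatisfyBody] using h)
  | next φ₁ =>
    exact hM.mem_of_rule (SatRule.next _ φ₁ t ht).mem
      (by simpa using ⟨hd, hη (by simp [encode]), h⟩) (by simp)
  | always φ₁ =>
    exact hM.mem_of_rule (SatRule.always _ φ₁ t ht).mem
      (by simpa using ⟨hd, hη (by simp [encode]), h⟩) (by simp)
  | eventually φ₁ =>
    obtain ⟨t₁, ht₁, ht₁', h⟩ := h
    exact hM.mem_of_rule (SatRule.eventually _ φ₁ t t₁ ht₁ ht₁').mem
      (by simpa using ⟨hd, hη (by simp [encode]), h⟩) (by simp)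
  | _ φ₁ φ₂ =>
    rcases h with h | ⟨t₁, ht₁, ht₁', h⟩
    · exact hM.mem_of_rule (SatRule.until_now _ φ₁ φ₂ t ht).mem
        (by simpa using ⟨hd, hη (by simp [encode]), h⟩) (by simp)
    · exact hM.mem_of_rule (SatRule.until_later _ φ₁ φ₂ t t₁ ht₁ ht₁').mem
        (by simpa using ⟨hd, hη (by simp [encode]), h⟩) (by simp)

theorem during_supported (hM : IsAnswerSet (desirePlanProgram D I G length φ) M)
    {η : Desire A F} {t t₁ : ℕ} (h : Atom.during η t t₁ ∈ M) :
    Atom.satisfy η t ∈ M ∧ (t = t₁ ∨ Atom.during η (t + 1) t₁ ∈ M) := by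
  obtain ⟨r, hr, hh, hpos, hneg⟩ := hM.supported h
  rcases mem_desirePlanProgram_iff.1 hr with h | h | rfl | ⟨a, ha, rfl⟩ | ⟨l, rfl⟩ | h
  · cases h <;> cases hh
  · obtain ⟨ψ, t', h', -⟩ := exists_formulaRuleFor h
    rw [h'] at hh
    cases hh
  · cases hh
  · cases hh
    exact (encodesOperator_of_mem_encode ha).elim
  · cases hh
  · cases h <;> cases hh
    · exact ⟨hpos _ (by simp), .inr (hpos _ (by simp))⟩
    · exact ⟨hpos _ (by simp), .inl rfl⟩

/-- The recursion for `during` starts at the right end `t₁`, so the induction runs downwards in `t`.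
-/
theorem during_mem_iff (hM : IsAnswerSet (desirePlanProgram D I G length φ) M)
    {η : Desire A F} (hη : encode η ⊆ M) {t t₁ : ℕ} (htt : t ≤ t₁) (ht : t₁ ≤ length) :
    Atom.during η t t₁ ∈ M ↔ ∀ i, t ≤ i → i ≤ t₁ → Atom.satisfy η i ∈ M := by
  have hd := hη (desire_mem_encode η)
  induction htt using Nat.decreasingInduction with
  | self =>
    constructor
    · intro h i hi hi'
      rw [le_antisymm hi' hi]
      exact (during_supported hM h).1
    · intro h
      exact hM.mem_of_rule (SatRule.during_base η t₁ ht).mem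
        (by simpa using ⟨hd, h t₁ le_rfl le_rfl⟩) (by simp)
  | of_succ t htt ih =>
    constructor
    · intro h i hi hi'
      obtain ⟨h₁, h₂ | h₂⟩ := during_supported hM h
      · omega
      · rcases hi.eq_or_lt with rfl | hi
        · exact h₁
        · exact ih.1 h₂ i hi hi'
    · intro h
      exact hM.mem_of_rule (SatRule.during_step η t t₁ htt ht).mem
        (by simpa using ⟨hd, h t le_rfl htt.le, ih.2 fun i hi hi' => h i (by omega) hi'⟩)
        (by simp)

theorem satisfy_ofFluent_mem_iff (hM : IsAnswerSet (desirePlanProgram D I G length φ) M)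
    {ψ : FluentFormula F} (hψ : encode (Desire.ofFluent ψ) ⊆ M) {t : ℕ} (ht : t ≤ length) :
    Atom.satisfy (.ofFluent ψ) t ∈ M ↔ ψ.Holds (stateAt M t) := by
  induction ψ with
  | lit l => exact satisfy_mem_iff hM hψ ht
  | and ψ₁ ψ₂ h₁ h₂ | or ψ₁ ψ₂ h₁ h₂ =>
    have hψ₁ : encode (Desire.ofFluent ψ₁) ⊆ M := fun a ha => hψ (.inl (.inl ha))
    have hψ₂ : encode (Desire.ofFluent ψ₂) ⊆ M := fun a ha => hψ (.inl (.inr ha))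
    rw [satisfy_mem_iff hM hψ ht, FluentFormula.Holds, ← h₁ hψ₁, ← h₂ hψ₂]
    rfl
  | neg ψ h =>
    have hψ' : encode (Desire.ofFluent ψ) ⊆ M := fun a ha => hψ (.inl ha)
    rw [satisfy_mem_iff hM hψ ht, FluentFormula.Holds, ← h hψ']
    rfl

/-- `M` contains `satisfy(η, t)` exactly if `η` is satisfied by the part of `α` from time `t` on;
after the end of `α` this is its last state. -/
theorem Represents.satisfy_mem_iff (hM : IsAnswerSet (desirePlanProgram D I G length φ) M)
    (hI : IsState D I) {α : Trajectory A F} (hα : Represents length M α) {η : Desire A F}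
    (hη : encode η ⊆ M) (hnext : α.len = length ∨ η.NextFree) {t : ℕ} (ht : t ≤ length) :
    Atom.satisfy η t ∈ M ↔ η.SatAt α (min t α.len) := by
  have hlen := hα.1
  have hs : ∀ i, α.state i = stateAt M i := hα.2.1
  have hmin : min t α.len ≤ α.len := min_le_right _ _
  induction η generalizing t with
  | goal ψ =>
    rw [PlanPref.satisfy_mem_iff hM hη ht, Desire.satAt_goal hmin, hs, SatisfyBody,
      satisfy_ofFluent_mem_iff hM _ le_rfl, hα.stateAt_eq hM hI le_rfl, min_eq_right hlen]
    · rfl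
    · rw [encode_ofFluent]
      exact fun a ha => hη (.inl ha)
  | lit l =>
    rw [PlanPref.satisfy_mem_iff hM hη ht, Desire.satAt_iff hmin]
    change l ∈ stateAt M t ↔ l ∈ α.state ⟨min t α.len + 0, _⟩
    rw [hs, hα.stateAt_eq hM hI ht]
    rfl
  | occ a =>
    rw [PlanPref.satisfy_mem_iff hM hη ht, Desire.satAt_occ hmin, SatisfyBody, hα.2.2]
    constructor
    · rintro ⟨h, ha⟩
      have : min t α.len = t := min_eq_left h.le
      simp only [this]
      exact ⟨h, ha⟩
    · rintro ⟨h, ha⟩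
      have : min t α.len = t := by omega
      simp only [this] at h ha
      exact ⟨h, ha⟩
  | and φ₁ φ₂ h₁ h₂ | or φ₁ φ₂ h₁ h₂ =>
    have e₁ : encode φ₁ ⊆ M := fun a ha => hη (.inl (.inl ha))
    have e₂ : encode φ₂ ⊆ M := fun a ha => hη (.inl (.inr ha))
    have i₁ : Atom.satisfy φ₁ t ∈ M ↔ φ₁.SatAt α (min t α.len) :=
      h₁ e₁ (hnext.imp_right And.left) ht hmin
    have i₂ : Atom.satisfy φ₂ t ∈ M ↔ φ₂.SatAt α (min t α.len) :=
      h₂ e₂ (hnext.imp_right And.right) ht hmin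
    rw [PlanPref.satisfy_mem_iff hM hη ht, SatisfyBody, i₁, i₂]
    simp only [Desire.satAt_iff hmin, Desire.Sat]
  | neg φ₁ h₁ =>
    have e₁ : encode φ₁ ⊆ M := fun a ha => hη (.inl ha)
    have i₁ : Atom.satisfy φ₁ t ∈ M ↔ φ₁.SatAt α (min t α.len) := h₁ e₁ hnext ht hmin
    rw [PlanPref.satisfy_mem_iff hM hη ht, SatisfyBody, i₁]
    simp only [Desire.satAt_iff hmin, Desire.Sat]
  | next φ₁ h₁ =>
    have e₁ : encode φ₁ ⊆ M := fun a ha => hη (.inl ha)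
    have hl : α.len = length := hnext.resolve_right id
    rw [PlanPref.satisfy_mem_iff hM hη ht, Desire.satAt_next hmin, SatisfyBody,
      min_eq_left (by omega)]
    -- At the final time both sides fail: no `satisfy` atom lies beyond `length`, and `α` has no
    -- position beyond its end.
    rcases ht.eq_or_lt with rfl | ht'
    · exact iff_of_false (fun h => by have := (satisfy_supported hM h).1; omega)
        fun h => by have := h.1; omega
    · have i₁ : Atom.satisfy φ₁ (t + 1) ∈ M ↔ φ₁.SatAt α (min (t + 1) α.len) :=
        h₁ e₁ (.inl hl) ht' (min_le_right _ _)
      rw [i₁, min_eq_left (by omega)]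
  | always φ₁ h₁ =>
    have e₁ : encode φ₁ ⊆ M := fun a ha => hη (.inl ha)
    have i₁ : ∀ {i}, i ≤ length → (Atom.satisfy φ₁ i ∈ M ↔ φ₁.SatAt α (min i α.len)) :=
      fun hi => h₁ e₁ hnext hi (min_le_right _ _)
    rw [PlanPref.satisfy_mem_iff hM hη ht, Desire.satAt_always hmin, SatisfyBody,
      during_mem_iff hM e₁ ht le_rfl]
    constructor
    · intro h j hj hj'
      -- Within `α`, time `j` itself serves; past its end the only position left is the last one,
      -- which time `t` represents.
      rcases le_total t α.len with htα | htα
      · have := (i₁ (by omega)).1 (h j (by omega) (by omega))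
        rwa [min_eq_left (by omega)] at this
      · have := (i₁ ht).1 (h t le_rfl ht)
        rwa [show min t α.len = j by omega] at this
    · intro h i hi hi'
      exact (i₁ hi').2 (h _ (by omega) (by omega))
  | eventually φ₁ h₁ =>
    have e₁ : encode φ₁ ⊆ M := fun a ha => hη (.inl ha)
    have i₁ : ∀ {i}, i ≤ length → (Atom.satisfy φ₁ i ∈ M ↔ φ₁.SatAt α (min i α.len)) :=
      fun hi => h₁ e₁ hnext hi (min_le_right _ _)
    rw [PlanPref.satisfy_mem_iff hM hη ht, Desire.satAt_eventually hmin, SatisfyBody]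
    constructor
    · rintro ⟨t₁, htt, ht₁, h⟩
      exact ⟨min t₁ α.len, by omega, (i₁ ht₁).1 h⟩
    · rintro ⟨j, hj, h⟩
      have hjα := h.1
      rcases le_total t α.len with htα | htα
      · refine ⟨j, by omega, by omega, (i₁ (by omega)).2 ?_⟩
        rwa [min_eq_left (by omega)]
      · refine ⟨t, le_rfl, ht, (i₁ ht).2 ?_⟩
        rwa [show min t α.len = j by omega]
  | _ φ₁ φ₂ h₁ h₂ =>
    have e₁ : encode φ₁ ⊆ M := fun a ha => hη (.inl (.inl ha))
    have e₂ : encode φ₂ ⊆ M := fun a ha => hη (.inl (.inr ha))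
    have i₁ : ∀ {i}, i ≤ length → (Atom.satisfy φ₁ i ∈ M ↔ φ₁.SatAt α (min i α.len)) :=
      fun hi => h₁ e₁ (hnext.imp_right And.left) hi (min_le_right _ _)
    have i₂ : ∀ {i}, i ≤ length → (Atom.satisfy φ₂ i ∈ M ↔ φ₂.SatAt α (min i α.len)) :=
      fun hi => h₂ e₂ (hnext.imp_right And.right) hi (min_le_right _ _)
    rw [PlanPref.satisfy_mem_iff hM hη ht, Desire.satAt_until hmin, SatisfyBody]
    constructor
    · rintro (h | ⟨t₁, htt, ht₁, hd, h⟩)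
      · exact ⟨_, le_rfl, fun m _ _ => by omega, (i₂ ht).1 h⟩
      -- A witness in the padding is pulled back to the last position; the positions before it
      -- precede `t₁`, so `during` covers them.
      · refine ⟨min t₁ α.len, by omega, fun m hm hm' => ?_, (i₂ ht₁).1 h⟩
        have := (i₁ (by omega)).1
          ((during_mem_iff hM e₁ (by omega) (by omega)).1 hd m (by omega) (by omega))
        rwa [min_eq_left (by omega)] at this
    · rintro ⟨j, hj, hd, h⟩
      have hjα := h.1
      -- A position `j` strictly after `min t α.len` but within `α` forces `t < α.len`, so `j` is a
      -- later time and the rule with `during` applies.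
      rcases hj.eq_or_lt with rfl | hj
      · exact .inl ((i₂ ht).2 h)
      · refine .inr ⟨j, by omega, by omega,
          (during_mem_iff hM e₁ (by omega) (by omega)).2 fun i hi hi' => (i₁ (by omega)).2 ?_,
          (i₂ (by omega)).2 ?_⟩
        · rw [min_eq_left (by omega)]
          exact hd i (by omega) (by omega)
        · rwa [min_eq_left (by omega)]

end Program

end PlanPref

theorem mainTheorem6 {A F : Type*} (D : Set (PlanPref.Law A F))
    (I : Set (PlanPref.Literal F)) (G : PlanPref.FluentFormula F) (length : ℕ)
    (hcons : PlanPref.Consistent D I) (φ : PlanPref.Desire A F)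
    (M : Set (PlanPref.Atom A F))
    (hM : PlanPref.IsAnswerSet (PlanPref.desirePlanProgram D I G length φ) M) :
    ∃ α : PlanPref.Trajectory A F,
      (PlanPref.Represents length M α ∧
        ∀ β : PlanPref.Trajectory A F, PlanPref.Represents length M β → β = α) ∧
      α.IsTrajectory D ∧ α.Achieves I G ∧
      (α.len = length ∨ φ.NextFree →
        (φ.Sat α ↔ PlanPref.Atom.satisfy φ 0 ∈ M) ∧
        (PlanPref.Atom.satisfy φ 0 ∈ M → PlanPref.MostPreferred D φ α)) := by
  obtain ⟨α, hα⟩ := PlanPref.exists_represents hM hcons.1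
  have hsub : PlanPref.encode φ ⊆ M := fun a ha => PlanPref.mem_of_mem_encode hM ha
  have htraj := hα.isTrajectory hM hcons.1
  refine ⟨α, ⟨hα, fun β hβ => hα.unique hβ⟩, htraj, hα.achieves hM hcons.1, fun hnext => ?_⟩
  have hiff : φ.Sat α ↔ PlanPref.Atom.satisfy φ 0 ∈ M := by
    rw [hα.satisfy_mem_iff hM hcons.1 hsub hnext (Nat.zero_le _), Nat.zero_min,
      PlanPref.Desire.satAt_zero]
  exact ⟨hiff, fun h => ⟨htraj, fun ⟨β, _, _, hn⟩ => hn (hiff.2 h)⟩⟩
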